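/- Conventions. Semigroups and subsemigroups are non-empty. For a non-empty set $A$ let $A^+$ be the free semigroup and $A^*$ the free monoid on $A$. A rewriting system over $A$ is a set $R \subseteq A^+ \times A^+$ of rules $X \to Y$. Write $W_1 \to_R W_2$ if $W_1 = Z_1 X Z_2$ and $W_2 = Z_1 Y Z_2$ for some rule $X \to Y$ in $R$ and some $Z_1, Z_2 \in A^*$, and let $\to_R^*$ be the reflexive transitive closure of $\to_R$. The system $R$ is complete if there is no infinite sequence $W_1 \to_R W_2 \to_R W_3 \to_R \cdots$ and if, whenever $U \to_R^* V$ and $U \to_R^* W$, there is an $X \in A^+$ with $V \to_R^* X$ and $W \to_R^* X$. A semigroup $S$ has a finite complete rewriting system if there are a finite non-empty set $A$ and a finite complete rewriting system $R$ over $A$ such that $S$ is isomorphic to the quotient of $A^+$ by the congruence generated by $R$. Corollary 1.2. Let $S$ be a semigroup and let $T$ be a subsemigroup of $S$ such that $S \setminus T$ is finite (that is, $S$ is a small extension of $T$). Then $S$ has a finite complete rewriting system if and only if $T$ has a finite complete rewriting system. -/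

import Mathlib

namespace StringRewriting

/-- A rewriting system over the alphabet `A`: a set of rules `U → V`, that is, of pairs of
non-empty words. The free semigroup `FreeSemigroup A` is `A⁺`, the free monoid `FreeMonoid A`
is `A*`. -/
abbrev RewritingSystem (A : Type*) := Set (FreeSemigroup A × FreeSemigroup A)

/-- The canonical inclusion `A⁺ → A*`, which sends the letter `a` to the letter `a`. -/
def incl {A : Type*} : FreeSemigroup A →ₙ* FreeMonoid A :=
  FreeSemigroup.lift FreeMonoid.of

/-- One-step reduction: `W₁ = Z₁ X Z₂` and `W₂ = Z₁ Y Z₂` for some rule `X → Y` of `R` and some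
possibly empty words `Z₁`, `Z₂`; the equations are read in `A*`. -/
def Step {A : Type*} (R : RewritingSystem A) (W₁ W₂ : FreeSemigroup A) : Prop :=
  ∃ X Y : FreeSemigroup A, (X, Y) ∈ R ∧ ∃ Z₁ Z₂ : FreeMonoid A,
    incl W₁ = Z₁ * incl X * Z₂ ∧ incl W₂ = Z₁ * incl Y * Z₂

/-- The reflexive transitive closure of one-step reduction. -/
def Reduces {A : Type*} (R : RewritingSystem A) : FreeSemigroup A → FreeSemigroup A → Prop :=
  Relation.ReflTransGen (Step R)

/-- There is no infinite reduction sequence. -/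
def IsNoetherian {A : Type*} (R : RewritingSystem A) : Prop :=
  ¬ ∃ W : ℕ → FreeSemigroup A, ∀ n, Step R (W n) (W (n + 1))

/-- Any two words obtained by reducing the same word can be reduced to a common word. -/
def IsConfluent {A : Type*} (R : RewritingSystem A) : Prop :=
  ∀ U V W : FreeSemigroup A, Reduces R U V → Reduces R U W →
    ∃ X : FreeSemigroup A, Reduces R V X ∧ Reduces R W X

/-- A complete rewriting system: Noetherian and confluent. -/
def IsComplete {A : Type*} (R : RewritingSystem A) : Prop :=
  IsNoetherian R ∧ IsConfluent R

/-- The congruence on `A⁺` generated by the rules of `R`. -/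
def congruence {A : Type*} (R : RewritingSystem A) : Con (FreeSemigroup A) :=
  conGen fun U V => (U, V) ∈ R

/-- `[A ; R]` is a semigroup presentation for `S`: the quotient of `A⁺` by the congruence
generated by `R` is isomorphic to `S`. -/
def Presents {A : Type*} (R : RewritingSystem A) (S : Type*) [Semigroup S] : Prop :=
  Nonempty ((congruence R).Quotient ≃* S)

/-- `S` has a finite complete rewriting system: `S` has a semigroup presentation `[A ; R]` with
a finite non-empty alphabet `A` and a finite complete set of rules `R`. As `A` is finite, it is
no restriction to take it in the lowest universe. -/
def HasFiniteCompleteRewritingSystem (S : Type*) [Semigroup S] : Prop :=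
  ∃ (A : Type) (R : RewritingSystem A),
    Finite A ∧ Nonempty A ∧ R.Finite ∧ IsComplete R ∧ Presents R S

/-- `T` is a large subsemigroup of `S`, and `S` a small extension of `T`: the set `S \ T` is
finite. A subsemigroup is non-empty, as every semigroup is, whereas the empty set is a
`Subsemigroup` in Mathlib. -/
def IsSmallExtension {S : Type*} [Semigroup S] (T : Subsemigroup S) : Prop :=
  (T : Set S).Nonempty ∧ ((T : Set S)ᶜ).Finite

end StringRewriting

/-! A finite presentation is complete once reduction terminates and distinct irreducible words have
distinct values; confluence then needs no critical pairs. `IsCompletePresentation` has this form,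
inside the ambient semigroup `S`.

From `T` to `S`: each element of `S \ T` becomes a new letter, and every two-letter word containing
a new letter is rewritten to a fixed word for its value, either one new letter or a word over the
old alphabet. Irreducible words are then single new letters or old irreducible words
(`IsCompletePresentation.extend`). Termination is the delicate point (`wellFounded_extendedRules`).

From `S` to `T`: only finitely many irreducible words have values outside `T`, so those of length at
least some `m` all have values in `T`. The new letters are blocks, words of length at most `2 * m`
with value in `T`. Block words are rewritten by imitating `R` on the word they spell, and by
respelling two adjacent blocks so as to lengthen the first. An irreducible word can be cut wherever
both parts keep `m` letters, and this freedom makes the locally optimal spelling unique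
(`IsTight.eq_of_expand_eq`). -/

namespace StringRewriting

/-! ### Reduction and evaluation of words -/

/-- One-step reduction on lists. -/
def ListStep {A : Type*} (R : Set (List A × List A)) (u v : List A) : Prop :=
  ∃ p ∈ R, ∃ x y : List A, u = x ++ p.1 ++ y ∧ v = x ++ p.2 ++ y

/-- The value in `S¹` of a word under an assignment of elements of `S` to the letters. -/
def wordEval {A S : Type*} [Semigroup S] (f : A → S) (l : List A) : WithOne S :=
  (l.map fun a => (f a : WithOne S)).prod

/-- The rules `R` on lists and the values `f` of the letters form a complete presentation of the
subsemigroup `T`: reduction is well-founded, and each element of `T` is the value of a word, where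
different irreducible words have different values. -/
structure IsCompletePresentation {A S : Type*} [Semigroup S] (T : Subsemigroup S)
    (R : Set (List A × List A)) (f : A → S) : Prop where
  fst_ne_nil : ∀ p ∈ R, p.1 ≠ []
  snd_ne_nil : ∀ p ∈ R, p.2 ≠ []
  mem : ∀ a, f a ∈ T
  sound : ∀ p ∈ R, wordEval f p.1 = wordEval f p.2
  surj : ∀ t ∈ T, ∃ l, wordEval f l = t
  wf : WellFounded fun v u => ListStep R u v
  inj : ∀ u v, (∀ w, ¬ ListStep R u w) → (∀ w, ¬ ListStep R v w) →
    wordEval f u = wordEval f v → u = v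

section ListStep

variable {A : Type*} {R : Set (List A × List A)}

theorem ListStep.context {u v : List A} (h : ListStep R u v) (x y : List A) :
    ListStep R (x ++ u ++ y) (x ++ v ++ y) := by
  obtain ⟨p, hp, a, b, rfl, rfl⟩ := h
  exact ⟨p, hp, x ++ a, b ++ y, by simp, by simp⟩

theorem exists_irreducible (wf : WellFounded fun v u => ListStep R u v) (u : List A) :
    ∃ v, Relation.ReflTransGen (ListStep R) u v ∧ ∀ w, ¬ ListStep R v w := by
  induction u using wf.induction with
  | _ u ih =>
    by_cases h : ∃ w, ListStep R u w
    · obtain ⟨w, hw⟩ := h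
      obtain ⟨v, hv, hi⟩ := ih w hw
      exact ⟨v, .head hw hv, hi⟩
    · exact ⟨u, .refl, fun w hw => h ⟨w, hw⟩⟩

theorem irreducible_of_infix {u x y : List A} (h : ∀ w, ¬ ListStep R (x ++ u ++ y) w) :
    ∀ w, ¬ ListStep R u w := fun _ hw => h _ (hw.context x y)

end ListStep

section wordEval

variable {A S : Type*} [Semigroup S] (f : A → S)

@[simp] theorem wordEval_nil : wordEval f [] = 1 := rfl

@[simp] theorem wordEval_cons (a : A) (l : List A) :
    wordEval f (a :: l) = f a * wordEval f l := by simp [wordEval]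

@[simp] theorem wordEval_append (l l' : List A) :
    wordEval f (l ++ l') = wordEval f l * wordEval f l' := by simp [wordEval]

variable {f}

theorem exists_wordEval_eq {T : Subsemigroup S} (hf : ∀ a, f a ∈ T) {l : List A} (hl : l ≠ []) :
    ∃ t ∈ T, wordEval f l = t := by
  induction l with
  | nil => exact absurd rfl hl
  | cons a l ih =>
    rcases eq_or_ne l [] with rfl | h
    · exact ⟨f a, hf a, by simp⟩
    · obtain ⟨t, ht, e⟩ := ih h
      exact ⟨f a * t, T.mul_mem (hf a) ht, by simp [e]⟩

theorem wordEval_eq_one_iff {l : List A} : wordEval f l = 1 ↔ l = [] := by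
  refine ⟨fun h => ?_, fun h => by simp [h]⟩
  by_contra hl
  obtain ⟨t, -, e⟩ := exists_wordEval_eq (T := ⊤) (f := f) (fun _ => trivial) hl
  exact WithOne.coe_ne_one (e.symm.trans h)

theorem wordEval_eq_of_step {R : Set (List A × List A)}
    (hs : ∀ p ∈ R, wordEval f p.1 = wordEval f p.2) {u v : List A} (h : ListStep R u v) :
    wordEval f u = wordEval f v := by
  obtain ⟨p, hp, x, y, rfl, rfl⟩ := h
  simp [hs p hp]

theorem wordEval_eq_of_reduces {R : Set (List A × List A)}
    (hs : ∀ p ∈ R, wordEval f p.1 = wordEval f p.2) {u v : List A}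
    (h : Relation.ReflTransGen (ListStep R) u v) : wordEval f u = wordEval f v := by
  induction h with
  | refl => rfl
  | tail _ h ih => exact ih.trans (wordEval_eq_of_step hs h)

end wordEval

/-! ### Translation between the free semigroup and lists -/

/-- The list of letters of a non-empty word. -/
def letters {A : Type*} (W : FreeSemigroup A) : List A := W.head :: W.tail

theorem letters_ne_nil {A : Type*} (W : FreeSemigroup A) : letters W ≠ [] := List.cons_ne_nil _ _

theorem letters_injective {A : Type*} : Function.Injective (letters (A := A)) := by
  rintro ⟨a, l⟩ ⟨b, l'⟩ h
  simpa [letters] using h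

theorem exists_letters_eq {A : Type*} {l : List A} (h : l ≠ []) : ∃ W, letters W = l := by
  cases l with
  | nil => exact absurd rfl h
  | cons a l => exact ⟨⟨a, l⟩, rfl⟩

theorem letters_mul {A : Type*} (U V : FreeSemigroup A) :
    letters (U * V) = letters U ++ letters V := rfl

theorem toList_incl {A : Type*} (W : FreeSemigroup A) : (incl W).toList = letters W := by
  induction W with
  | ih1 a => rfl
  | ih2 a y _ ih => rw [map_mul, FreeMonoid.toList_mul, ih]; rfl

/-- The rules on lists that correspond to a rewriting system. -/
def listRules {A : Type*} (R : RewritingSystem A) : Set (List A × List A) :=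
  (fun p => (letters p.1, letters p.2)) '' R

theorem step_iff {A : Type*} {R : RewritingSystem A} {U V : FreeSemigroup A} :
    Step R U V ↔ ListStep (listRules R) (letters U) (letters V) := by
  simp only [← toList_incl]
  constructor
  · rintro ⟨X, Y, h, Z₁, Z₂, h₁, h₂⟩
    exact ⟨_, ⟨_, h, rfl⟩, Z₁.toList, Z₂.toList, by simp [h₁, toList_incl], by simp [h₂, toList_incl]⟩
  · rintro ⟨_, ⟨⟨X, Y⟩, h, rfl⟩, x, y, h₁, h₂⟩
    refine ⟨X, Y, h, FreeMonoid.ofList x, FreeMonoid.ofList y, ?_, ?_⟩ <;>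
    apply FreeMonoid.toList.injective
    · simpa [toList_incl] using h₁
    · simpa [toList_incl] using h₂

theorem exists_letters_eq_of_step {A : Type*} {R : RewritingSystem A} {u v : List A}
    (h : ListStep (listRules R) u v) : ∃ U V, letters U = u ∧ letters V = v ∧ Step R U V := by
  obtain ⟨_, ⟨⟨X, Y⟩, hp, rfl⟩, x, y, rfl, rfl⟩ := id h
  obtain ⟨U, hU⟩ := exists_letters_eq (l := x ++ letters X ++ y) (by simp [letters_ne_nil])
  obtain ⟨V, hV⟩ := exists_letters_eq (l := x ++ letters Y ++ y) (by simp [letters_ne_nil])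
  exact ⟨U, V, hU, hV, step_iff.2 (by rw [hU, hV]; exact h)⟩

theorem isNoetherian_iff {A : Type*} {R : RewritingSystem A} :
    IsNoetherian R ↔ WellFounded fun v u => ListStep (listRules R) u v := by
  rw [wellFounded_iff_isEmpty_descending_chain, isEmpty_subtype, IsNoetherian, not_exists]
  constructor
  · intro h f hf
    have key : ∀ n, ∃ W, letters W = f n := fun n => by
      obtain ⟨U, -, hU, -⟩ := exists_letters_eq_of_step (hf n)
      exact ⟨U, hU⟩
    choose W hW using key
    exact h W fun n => step_iff.2 (by rw [hW, hW]; exact hf n)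
  · intro h W hW
    exact h (fun n => letters (W n)) fun n => step_iff.1 (hW n)

theorem reduces_iff {A : Type*} {R : RewritingSystem A} {U V : FreeSemigroup A} :
    Reduces R U V ↔ Relation.ReflTransGen (ListStep (listRules R)) (letters U) (letters V) := by
  constructor
  · exact fun h => h.lift letters fun _ _ => step_iff.1
  · intro h
    generalize hu : letters U = u at h
    generalize hv : letters V = v at h
    induction h generalizing V with
    | refl => rw [letters_injective (hu.trans hv.symm)]; exact .refl
    | tail _ h ih =>
      obtain ⟨U', V', rfl, rfl, h'⟩ := exists_letters_eq_of_step h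
      rw [letters_injective hv]
      exact (ih rfl).tail h'

theorem reduces_mul {A : Type*} {R : RewritingSystem A} {U V U' V' : FreeSemigroup A}
    (h : Reduces R U V) (h' : Reduces R U' V') : Reduces R (U * U') (V * V') := by
  rw [reduces_iff] at *
  simp only [letters_mul]
  refine .trans (h.lift (· ++ letters U') fun a b hab => ?_)
    (h'.lift (letters V ++ ·) fun a b hab => ?_)
  · exact hab.context [] _
  · simpa using hab.context (letters V) []

theorem congruence_of_reduces {A : Type*} {R : RewritingSystem A} {U V : FreeSemigroup A}
    (h : Reduces R U V) : congruence R U V := by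
  induction h with
  | refl => exact (congruence R).refl _
  | @tail V W _ h ih =>
    refine (congruence R).trans ih ?_
    obtain ⟨X, Y, hp, Z₁, Z₂, h₁, h₂⟩ := h
    have hXY : congruence R X Y := ConGen.Rel.of _ _ hp
    -- A context may be empty, hence not an element of the free semigroup; the four cases avoid
    -- multiplying by it.
    have key : ∀ (x y : List A) (V W : FreeSemigroup A), letters V = x ++ letters X ++ y →
        letters W = x ++ letters Y ++ y → congruence R V W := by
      intro x y V W hV hW
      rcases eq_or_ne x [] with rfl | hx <;> rcases eq_or_ne y [] with rfl | hy
      · simp only [List.nil_append, List.append_nil] at hV hW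
        rwa [letters_injective hV, letters_injective hW]
      · obtain ⟨y, rfl⟩ := exists_letters_eq hy
        simp only [List.nil_append, ← letters_mul] at hV hW
        rw [letters_injective hV, letters_injective hW]
        exact (congruence R).mul hXY ((congruence R).refl _)
      · obtain ⟨x, rfl⟩ := exists_letters_eq hx
        simp only [List.append_nil, ← letters_mul] at hV hW
        rw [letters_injective hV, letters_injective hW]
        exact (congruence R).mul ((congruence R).refl _) hXY
      · obtain ⟨x, rfl⟩ := exists_letters_eq hx
        obtain ⟨y, rfl⟩ := exists_letters_eq hy
        simp only [← letters_mul] at hV hW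
        rw [letters_injective hV, letters_injective hW]
        exact (congruence R).mul ((congruence R).mul ((congruence R).refl _) hXY)
          ((congruence R).refl _)
    refine key Z₁.toList Z₂.toList V W ?_ ?_
    · rw [← toList_incl, h₁]; simp [toList_incl]
    · rw [← toList_incl, h₂]; simp [toList_incl]

/-- Joinability, as a congruence. -/
def joinCon {A : Type*} {R : RewritingSystem A} (h : IsConfluent R) : Con (FreeSemigroup A) where
  r U V := ∃ X, Reduces R U X ∧ Reduces R V X
  iseqv :=
    { refl := fun U => ⟨U, .refl, .refl⟩
      symm := fun ⟨X, h₁, h₂⟩ => ⟨X, h₂, h₁⟩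
      trans := fun ⟨X, h₁, h₂⟩ ⟨Y, h₃, h₄⟩ => by
        obtain ⟨Z, hX, hY⟩ := h _ _ _ h₂ h₃
        exact ⟨Z, h₁.trans hX, h₄.trans hY⟩ }
  mul' := fun ⟨X, h₁, h₂⟩ ⟨Y, h₃, h₄⟩ => ⟨X * Y, reduces_mul h₁ h₃, reduces_mul h₂ h₄⟩

/-- The Church–Rosser property: confluence makes joinability transitive, so it is a congruence
containing the rules. -/
theorem exists_reduces_of_congruence {A : Type*} {R : RewritingSystem A} (h : IsConfluent R)
    {U V : FreeSemigroup A} (hUV : congruence R U V) : ∃ X, Reduces R U X ∧ Reduces R V X := by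
  have : congruence R ≤ joinCon h := Con.conGen_le.2 fun X Y hXY =>
    ⟨Y, .single ⟨X, Y, hXY, 1, 1, by simp, by simp⟩, .refl⟩
  exact this hUV

theorem wordEval_letters {A S : Type*} [Semigroup S] {T : Subsemigroup S}
    (φ : FreeSemigroup A →ₙ* T) (W : FreeSemigroup A) :
    wordEval (fun a => (φ (.of a) : S)) (letters W) = ((φ W : S) : WithOne S) := by
  induction W with
  | ih1 a => simp [letters]
  | ih2 a y _ ih => rw [letters_mul, wordEval_append, ih, map_mul]; simp [letters]

theorem exists_isCompletePresentation {S : Type*} [Semigroup S] {T : Subsemigroup S}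
    (h : HasFiniteCompleteRewritingSystem T) :
    ∃ (A : Type) (R : Set (List A × List A)) (f : A → S),
      Finite A ∧ R.Finite ∧ IsCompletePresentation T R f := by
  obtain ⟨A, R, hA, -, hR, ⟨hn, hc⟩, ⟨e⟩⟩ := h
  let φ : FreeSemigroup A →ₙ* T :=
    ⟨fun W => e (W : (congruence R).Quotient), fun U V => by rw [Con.coe_mul, map_mul]⟩
  have ev := wordEval_letters φ
  have hφ : ∀ U V, congruence R U V ↔ φ U = φ V := fun U V =>
    (Con.eq _).symm.trans e.injective.eq_iff.symm
  refine ⟨A, listRules R, fun a => φ (.of a), hA, hR.image _, ?_, ?_, ?_, ?_, ?_,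
    isNoetherian_iff.1 hn, ?_⟩
  · rintro _ ⟨p, -, rfl⟩; exact letters_ne_nil _
  · rintro _ ⟨p, -, rfl⟩; exact letters_ne_nil _
  · exact fun a => (φ (.of a)).2
  · rintro _ ⟨p, hp, rfl⟩
    simp only [ev]
    rw [(hφ p.1 p.2).1 (ConGen.Rel.of _ _ hp)]
  · intro t ht
    obtain ⟨q, hq⟩ := e.surjective ⟨t, ht⟩
    induction q using Con.induction_on with | _ W => ?_
    exact ⟨letters W, by rw [ev]; exact congrArg (fun x : T => ((x : S) : WithOne S)) hq⟩
  · intro u v hu hv huv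
    rcases eq_or_ne u [] with rfl | hu'
    · exact (wordEval_eq_one_iff.1 (huv.symm.trans (wordEval_nil _))).symm
    rcases eq_or_ne v [] with rfl | hv'
    · exact wordEval_eq_one_iff.1 (huv.trans (wordEval_nil _))
    obtain ⟨U, rfl⟩ := exists_letters_eq hu'
    obtain ⟨V, rfl⟩ := exists_letters_eq hv'
    rw [ev, ev, WithOne.coe_inj, Subtype.coe_inj] at huv
    obtain ⟨X, hX, hX'⟩ := exists_reduces_of_congruence hc ((hφ U V).2 huv)
    rw [reduces_iff] at hX hX'
    have aux : ∀ {w x : List A}, (∀ z, ¬ ListStep (listRules R) w z) →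
        Relation.ReflTransGen (ListStep (listRules R)) w x → w = x := by
      intro w x hw h
      rcases h.cases_head with h | ⟨z, h, -⟩
      · exact h
      · exact absurd h (hw z)
    rw [aux hu hX, aux hv hX']

/-- Words of equal value have equal normal forms. This yields confluence and identifies the
generated congruence with the kernel of evaluation. -/
theorem hasFiniteCompleteRewritingSystem_of_isCompletePresentation {S : Type*} [Semigroup S]
    {T : Subsemigroup S} (hT : (T : Set S).Nonempty) {A : Type} {R : Set (List A × List A)}
    {f : A → S} [Finite A] (hR : R.Finite) (h : IsCompletePresentation T R f) :
    HasFiniteCompleteRewritingSystem T := by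
  let Q : RewritingSystem A := (fun p => (letters p.1, letters p.2)) ⁻¹' R
  have hQ : listRules Q = R := by
    apply Set.image_preimage_eq_of_subset
    rintro ⟨x, y⟩ hp
    obtain ⟨X, hX⟩ := exists_letters_eq (h.fst_ne_nil _ hp)
    obtain ⟨Y, hY⟩ := exists_letters_eq (h.snd_ne_nil _ hp)
    exact ⟨(X, Y), Prod.ext hX hY⟩
  let φ : FreeSemigroup A →ₙ* T := FreeSemigroup.lift fun a => ⟨f a, h.mem a⟩
  have ev : ∀ W, wordEval f (letters W) = ((φ W : S) : WithOne S) := wordEval_letters φ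
  have hred : ∀ {U V}, Reduces Q U V → φ U = φ V := by
    intro U V hUV
    rw [reduces_iff, hQ] at hUV
    have := wordEval_eq_of_reduces h.sound hUV
    rwa [ev, ev, WithOne.coe_inj, Subtype.coe_inj] at this
  have hnf : ∀ U, ∃ V, Reduces Q U V ∧ ∀ w, ¬ ListStep R (letters V) w := by
    intro U
    obtain ⟨v, hv, hi⟩ := exists_irreducible h.wf (letters U)
    have hne : v ≠ [] := by
      rintro rfl
      have := wordEval_eq_of_reduces h.sound hv
      exact letters_ne_nil U (wordEval_eq_one_iff.1 (this.trans (wordEval_nil f)))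
    obtain ⟨V, rfl⟩ := exists_letters_eq hne
    exact ⟨V, by rwa [reduces_iff, hQ], hi⟩
  have hjoin : ∀ {V W}, φ V = φ W → ∃ X, Reduces Q V X ∧ Reduces Q W X := by
    intro V W hVW
    obtain ⟨V', hV, hV'⟩ := hnf V
    obtain ⟨W', hW, hW'⟩ := hnf W
    have : V' = W' := letters_injective <| h.inj _ _ hV' hW' (by
      rw [ev, ev, ← hred hV, ← hred hW, hVW])
    exact ⟨V', hV, this ▸ hW⟩
  have hker : ∀ U V, congruence Q U V ↔ φ U = φ V := by
    refine fun U V => ⟨fun hUV => ?_, fun hUV => ?_⟩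
    · have : congruence Q ≤ Con.ker φ := Con.conGen_le.2 fun X Y hXY =>
        hred (.single ⟨X, Y, hXY, 1, 1, by simp, by simp⟩)
      exact this hUV
    · obtain ⟨X, hX, hX'⟩ := hjoin hUV
      exact (congruence Q).trans (congruence_of_reduces hX)
        ((congruence Q).symm (congruence_of_reduces hX'))
  have hsurj : Function.Surjective φ := by
    rintro ⟨t, ht⟩
    obtain ⟨l, hl⟩ := h.surj t ht
    have hne : l ≠ [] := by rintro rfl; exact WithOne.one_ne_coe hl
    obtain ⟨W, rfl⟩ := exists_letters_eq hne
    rw [ev, WithOne.coe_inj] at hl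
    exact ⟨W, Subtype.ext hl⟩
  obtain ⟨t, ht⟩ := hT
  obtain ⟨W₀, -⟩ := hsurj ⟨t, ht⟩
  refine ⟨A, Q, inferInstance, ⟨W₀.head⟩, hR.preimage ?_, ⟨?_, ?_⟩, ⟨?_⟩⟩
  · rintro ⟨a, b⟩ - ⟨c, d⟩ - hp
    exact Prod.ext (letters_injective (congrArg Prod.fst hp))
      (letters_injective (congrArg Prod.snd hp))
  · rw [isNoetherian_iff, hQ]; exact h.wf
  · exact fun U V W hV hW => hjoin ((hred hV).symm.trans (hred hW))
  · let ψ : (congruence Q).Quotient →ₙ* T :=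
      { toFun := fun q => Con.liftOn q φ fun U V hUV => (hker U V).1 hUV
        map_mul' := fun p q => by
          induction p, q using Con.induction_on₂ with
          | _ U V => exact map_mul φ U V }
    refine MulEquiv.ofBijective ψ ⟨?_, ?_⟩
    · intro p q
      induction p, q using Con.induction_on₂ with
      | _ U V => exact fun hUV => (Con.eq _).2 ((hker U V).2 hUV)
    · intro t
      obtain ⟨W, rfl⟩ := hsurj t
      exact ⟨W, rfl⟩

theorem HasFiniteCompleteRewritingSystem.congr {S S' : Type*} [Semigroup S] [Semigroup S']
    (e : S ≃* S') (h : HasFiniteCompleteRewritingSystem S) :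
    HasFiniteCompleteRewritingSystem S' := by
  obtain ⟨A, R, hA, hA', hR, hc, ⟨i⟩⟩ := h
  exact ⟨A, R, hA, hA', hR, hc, ⟨i.trans e⟩⟩

/-! ### Termination for the extended alphabet -/

section Segments

variable {A B : Type*}

/-- The maximal words over `A` in a word over `A ⊕ B`, the first one being preceded by `u`. -/
def segments (u : List A) : List (A ⊕ B) → Multiset (List A)
  | [] => {u}
  | Sum.inl a :: l => segments (u ++ [a]) l
  | Sum.inr _ :: l => {u} + segments [] l

theorem segments_map_inl_append (u w : List A) (l : List (A ⊕ B)) :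
    segments u (w.map Sum.inl ++ l) = segments (u ++ w) l := by
  induction w generalizing u with
  | nil => simp
  | cons a w ih => simp [segments, ih]

/-- The segment begun by `u` or `v` continues up to the next letter of `B`, so the comparison is
needed after every right extension `w`. -/
theorem cutExpand_segments {r : List A → List A → Prop} {u v : List A}
    (h : ∀ w, r (v ++ w) (u ++ w)) (l : List (A ⊕ B)) :
    Relation.CutExpand r (segments v l) (segments u l) := by
  induction l generalizing u v with
  | nil => exact Relation.cutExpand_singleton_singleton (by simpa using h [])
  | cons a l ih =>
    cases a with
    | inl a => exact ih fun w => by simpa using h (a :: w)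
    | inr b =>
      exact (Relation.cutExpand_add_right _).2
        (Relation.cutExpand_singleton_singleton (by simpa using h []))

theorem cutExpand_segments_append {r : List A → List A → Prop} {l l' : List (A ⊕ B)}
    (h : ∀ u, Relation.CutExpand r (segments u l') (segments u l)) (x : List (A ⊕ B))
    (u : List A) : Relation.CutExpand r (segments u (x ++ l')) (segments u (x ++ l)) := by
  induction x generalizing u with
  | nil => exact h u
  | cons a x ih =>
    cases a with
    | inl a => exact ih _
    | inr b => exact (Relation.cutExpand_add_left _).2 (ih _)

/-- Reduction or passing to a proper factor. -/
def StepOrFactor (R : Set (List A × List A)) (v u : List A) : Prop :=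
  ListStep R u v ∨ (v <:+: u ∧ v.length < u.length)

/-- A step in a factor is a step in the whole word. Hence induction on the whole word, then on the
length of its factor. -/
theorem wellFounded_stepOrFactor {R : Set (List A × List A)}
    (wf : WellFounded fun v u => ListStep R u v) : WellFounded (StepOrFactor R) := by
  suffices h : ∀ u v : List A, v <:+: u → Acc (StepOrFactor R) v from
    ⟨fun u => h u u (List.infix_refl u)⟩
  intro u
  induction u using wf.induction with
  | _ u ihu =>
    intro v
    induction hn : v.length using Nat.strong_induction_on generalizing v with
    | _ n ihn =>
      rintro hv
      refine ⟨_, fun w hw => ?_⟩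
      rcases hw with hw | ⟨hw, hl⟩
      · obtain ⟨x, y, rfl⟩ := hv
        exact ihu _ (hw.context x y) w ⟨x, y, rfl⟩
      · exact ihn _ (hn ▸ hl) w rfl (hw.trans hv)

end Segments

/-! ### From `T` to `S` -/

section Extension

variable {A B S : Type*} [Semigroup S]

/-- The rules `R` together with rules that reduce every word of length two which contains a letter
from `B`. -/
def extendedRules (R : Set (List A × List A)) (ρ : A ⊕ B → A ⊕ B → List (A ⊕ B)) :
    Set (List (A ⊕ B) × List (A ⊕ B)) :=
  (fun p => (p.1.map Sum.inl, p.2.map Sum.inl)) '' R ∪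
    (fun q : (A ⊕ B) × (A ⊕ B) => ([q.1, q.2], ρ q.1 q.2)) '' {q | q.1.isRight ∨ q.2.isRight}

variable {R : Set (List A × List A)} {ρ : A ⊕ B → A ⊕ B → List (A ⊕ B)}

/-- The number of letters from `B` never grows. When it stays the same, exactly one maximal segment
over `A` changes: it is reduced by `R` or loses an end letter. -/
theorem wellFounded_extendedRules (wf : WellFounded fun v u => ListStep R u v)
    (hρ : ∀ a b, (∃ c, ρ a b = [Sum.inr c]) ∨ ∃ w : List A, ρ a b = w.map Sum.inl) :
    WellFounded fun v u => ListStep (extendedRules R ρ) u v := by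
  have hwf := (wellFounded_lt (α := ℕ)).prod_lex (wellFounded_stepOrFactor wf).cutExpand
  refine Subrelation.wf ?_ (InvImage.wf
    (fun l : List (A ⊕ B) => (l.countP Sum.isRight, segments [] l)) hwf)
  have cnt : ∀ w : List A, (w.map (Sum.inl : A → A ⊕ B)).countP Sum.isRight = 0 := fun w => by
    simp [List.countP_eq_zero]
  rintro v u ⟨p, hp, x, y, rfl, rfl⟩
  simp only [InvImage, Prod.lex_def, List.countP_append, List.append_assoc]
  rcases hp with ⟨p, hp, rfl⟩ | ⟨⟨a, b⟩, hab, rfl⟩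
  · refine Or.inr ⟨by simp [cnt], cutExpand_segments_append (fun u => ?_) x []⟩
    simp only [segments_map_inl_append]
    exact cutExpand_segments (fun w => Or.inl ⟨p, hp, u, w, rfl, rfl⟩) y
  · rcases hρ a b with ⟨c, hc⟩ | ⟨w, hw⟩
    · simp only [hc]
      rcases a with a | a <;> rcases b with b | b
      · simp at hab
      -- The segment before the letter of `B` loses its last letter; in the next case the segment
      -- after it loses its first.
      · refine Or.inr ⟨by simp [List.countP_cons], cutExpand_segments_append (fun u => ?_) x []⟩
        refine (Relation.cutExpand_add_right _).2 (Relation.cutExpand_singleton_singleton ?_)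
        exact Or.inr ⟨(List.prefix_append _ _).isInfix, by simp⟩
      · refine Or.inr ⟨by simp [List.countP_cons], cutExpand_segments_append (fun u => ?_) x []⟩
        refine (Relation.cutExpand_add_left _).2 (cutExpand_segments (fun w => ?_) y)
        exact Or.inr ⟨(List.suffix_append _ _).isInfix, by simp⟩
      · exact Or.inl (by simp [List.countP_cons])
    · refine Or.inl ?_
      simp only [hw, cnt]
      have : 0 < [a, b].countP Sum.isRight := List.countP_pos_iff.2 (by simpa using hab)
      omega

theorem IsCompletePresentation.extend {T : Subsemigroup S} {f : A → S}
    (h : IsCompletePresentation T R f) {e : B → S} (he : Function.Injective e)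
    (hT : ∀ s, s ∉ T ↔ s ∈ Set.range e) :
    ∃ ρ, IsCompletePresentation ⊤ (extendedRules R ρ) (Sum.elim f e) := by
  set g := Sum.elim f e with hg
  have gmap : ∀ w : List A, wordEval g (w.map Sum.inl) = wordEval f w := fun w => by
    simp [wordEval, hg, Function.comp_def]
  have key : ∀ s : S, ∃ l, wordEval g l = s ∧
      ((∃ c, l = [Sum.inr c]) ∨ ∃ w : List A, l = w.map Sum.inl) := by
    intro s
    by_cases hs : s ∈ T
    · obtain ⟨w, hw⟩ := h.surj s hs
      exact ⟨w.map Sum.inl, by rw [gmap, hw], Or.inr ⟨w, rfl⟩⟩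
    · obtain ⟨c, rfl⟩ := (hT s).1 hs
      exact ⟨[Sum.inr c], by simp [hg], Or.inl ⟨c, rfl⟩⟩
  choose rep hrep hshape using key
  refine ⟨fun a b => rep (g a * g b), ?_, ?_, fun _ => trivial, ?_, ?_, ?_, ?_⟩
  · rintro _ (⟨p, hp, rfl⟩ | ⟨q, -, rfl⟩)
    · simpa using h.fst_ne_nil p hp
    · simp
  · rintro _ (⟨p, hp, rfl⟩ | ⟨q, -, rfl⟩)
    · simpa using h.snd_ne_nil p hp
    · intro h0
      have := hrep (g q.1 * g q.2)
      simp only at h0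
      rw [h0] at this
      exact WithOne.one_ne_coe this
  · rintro _ (⟨p, hp, rfl⟩ | ⟨q, -, rfl⟩)
    · simpa only [gmap] using h.sound p hp
    · simp [hrep]
  · exact fun s _ => ⟨rep s, hrep s⟩
  · exact wellFounded_extendedRules h.wf fun a b => hshape _
  · have shape : ∀ u : List (A ⊕ B),
        (∀ w, ¬ ListStep (extendedRules R fun a b => rep (g a * g b)) u w) →
        (∃ c, u = [Sum.inr c]) ∨ ∃ w : List A, u = w.map Sum.inl ∧ ∀ z, ¬ ListStep R w z := by
      intro u hu
      by_cases hr : ∃ c, Sum.inr c ∈ u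
      · left
        obtain ⟨c, hc⟩ := hr
        obtain ⟨x, y, rfl⟩ := List.append_of_mem hc
        rcases List.eq_nil_or_concat x with rfl | ⟨x, a, rfl⟩
        · cases y with
          | nil => exact ⟨c, rfl⟩
          | cons b y =>
            exact absurd ⟨_, Or.inr ⟨(Sum.inr c, b), by simp, rfl⟩, [], y, by simp, rfl⟩ (hu _)
        · exact absurd ⟨_, Or.inr ⟨(a, Sum.inr c), by simp, rfl⟩, x, y, by simp, rfl⟩ (hu _)
      · right
        obtain ⟨w, rfl⟩ : ∃ w : List A, w.map Sum.inl = u := by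
          rw [← Set.mem_range, Set.range_list_map]
          rintro (a | c) hx
          · exact ⟨a, rfl⟩
          · exact absurd ⟨c, hx⟩ hr
        refine ⟨w, rfl, fun z hz => ?_⟩
        obtain ⟨p, hp, x, y, rfl, -⟩ := hz
        exact hu _ ⟨_, Or.inl ⟨p, hp, rfl⟩, x.map Sum.inl, y.map Sum.inl, by simp, rfl⟩
    have cross : ∀ (c : B) (w : List A), wordEval g [Sum.inr c] ≠ wordEval g (w.map Sum.inl) := by
      intro c w hcw
      rw [gmap] at hcw
      simp only [wordEval_cons, wordEval_nil, mul_one, hg, Sum.elim_inr] at hcw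
      rcases eq_or_ne w [] with rfl | hw
      · exact WithOne.coe_ne_one hcw
      · obtain ⟨t, ht, e'⟩ := exists_wordEval_eq h.mem hw
        rw [e', WithOne.coe_inj] at hcw
        exact (hT (e c)).2 ⟨c, rfl⟩ (hcw ▸ ht)
    intro u v hu hv huv
    rcases shape u hu with ⟨c, rfl⟩ | ⟨w, rfl, hw⟩ <;>
      rcases shape v hv with ⟨c', rfl⟩ | ⟨w', rfl, hw'⟩
    · simp only [wordEval_cons, wordEval_nil, mul_one, hg, Sum.elim_inr, WithOne.coe_inj] at huv
      rw [he huv]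
    · exact absurd huv (cross _ _)
    · exact absurd huv.symm (cross _ _)
    · rw [gmap, gmap] at huv
      rw [h.inj _ _ hw hw' huv]

end Extension

theorem hasFiniteCompleteRewritingSystem_of_subsemigroup {S : Type*} [Semigroup S]
    {T : Subsemigroup S} (hT : IsSmallExtension T) (h : HasFiniteCompleteRewritingSystem T) :
    HasFiniteCompleteRewritingSystem S := by
  obtain ⟨A, R, f, hA, hR, hp⟩ := exists_isCompletePresentation h
  obtain ⟨⟨t, -⟩, hfin⟩ := hT
  have := hfin.to_subtype
  -- Indexing by `Fin n` keeps the alphabet in `Type`, whatever the universe of `S`.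
  obtain ⟨n, ⟨e⟩⟩ := Finite.exists_equiv_fin ((T : Set S)ᶜ : Set S)
  obtain ⟨ρ, hρ⟩ := hp.extend (e := fun i : Fin n => (e.symm i : S))
    (Subtype.val_injective.comp e.symm.injective) fun s =>
      ⟨fun hs => ⟨e ⟨s, hs⟩, by simp⟩, by rintro ⟨i, rfl⟩; exact (e.symm i).2⟩
  exact (hasFiniteCompleteRewritingSystem_of_isCompletePresentation ⟨t, Subsemigroup.mem_top t⟩
    ((hR.image _).union (Set.toFinite _ |>.image _)) hρ).congr Subsemigroup.topEquiv

/-! ### Spelling words by blocks -/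

section Blocks

variable {A S : Type*} [Semigroup S]

/-- The value of the word `u` lies in `T`; in particular `u` is not empty. -/
def EvalMem (f : A → S) (T : Subsemigroup S) (u : List A) : Prop :=
  ∃ t ∈ T, wordEval f u = t

/-- Words of length at most `N` with value in `T`. -/
abbrev Block (f : A → S) (T : Subsemigroup S) (N : ℕ) : Type _ :=
  {u : List A // u.length ≤ N ∧ EvalMem f T u}

variable {f : A → S} {T : Subsemigroup S} {N : ℕ}

theorem EvalMem.append {u v : List A} (hu : EvalMem f T u) (hv : EvalMem f T v) :
    EvalMem f T (u ++ v) := by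
  obtain ⟨s, hs, hu⟩ := hu
  obtain ⟨t, ht, hv⟩ := hv
  exact ⟨s * t, T.mul_mem hs ht, by simp [hu, hv]⟩

theorem EvalMem.length_pos {u : List A} (hu : EvalMem f T u) : 0 < u.length := by
  rw [List.length_pos_iff]
  rintro rfl
  obtain ⟨t, -, h⟩ := hu
  exact WithOne.one_ne_coe h

/-- The word over `A` spelled by a list of blocks. -/
def expand (V : List (Block f T N)) : List A := (V.map Subtype.val).flatten

@[simp] theorem expand_nil : expand ([] : List (Block f T N)) = [] := rfl

@[simp] theorem expand_cons (b : Block f T N) (V : List (Block f T N)) :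
    expand (b :: V) = b.1 ++ expand V := rfl

@[simp] theorem expand_append (V W : List (Block f T N)) :
    expand (V ++ W) = expand V ++ expand W := by simp [expand]

theorem evalMem_expand {V : List (Block f T N)} (hV : V ≠ []) : EvalMem f T (expand V) := by
  induction V with
  | nil => exact absurd rfl hV
  | cons b V ih =>
    rcases eq_or_ne V [] with rfl | h
    · simpa using b.2.2
    · exact b.2.2.append (ih h)

theorem expand_eq_nil_iff {V : List (Block f T N)} : expand V = [] ↔ V = [] := by
  refine ⟨fun h => ?_, fun h => by simp [h]⟩
  by_contra hV
  have := (evalMem_expand hV).length_pos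
  simp [h] at this

/-- The sum of the lengths of the words spelled by the non-empty suffixes. -/
def cost : List (Block f T N) → ℕ
  | [] => 0
  | b :: V => (expand (b :: V)).length + cost V

theorem cost_append (V W : List (Block f T N)) :
    cost (V ++ W) = cost V + V.length * (expand W).length + cost W := by
  induction V with
  | nil => simp [cost]
  | cons b V ih => simp only [List.cons_append, cost, expand_cons, expand_append, ih,
      List.length_append, List.length_cons]; ring

/-- No factor of at most two blocks can be respelled by as many or fewer blocks at lower cost. -/
def IsTight (W : List (Block f T N)) : Prop :=
  ∀ x V y V' : List (Block f T N), W = x ++ V ++ y → V.length ≤ 2 → V'.length ≤ V.length →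
    expand V = expand V' → cost V ≤ cost V'

theorem IsTight.tail {b : Block f T N} {W : List (Block f T N)} (h : IsTight (b :: W)) :
    IsTight W := fun x V y V' e => h (b :: x) V y V' (by simp [e])

/-- Otherwise the two blocks could be merged into one, at lower cost. -/
theorem IsTight.lt_length_add_length {b c : Block f T N} {W : List (Block f T N)}
    (h : IsTight (b :: c :: W)) : N < b.1.length + c.1.length := by
  by_contra! hN
  have := h [] [b, c] W [⟨b.1 ++ c.1, by simpa using hN, b.2.2.append c.2.2⟩] rfl le_rfl
    (by simp) (by simp)
  have hc := c.2.2.length_pos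
  simp only [cost, expand_cons, expand_nil, List.append_nil, List.length_append] at this
  omega

/-- Two blocks `u`, `v` cost `|u| + 2|v|`; for a fixed product, the longer first block is cheaper.
-/
theorem IsTight.length_le {b c : Block f T N} {W : List (Block f T N)}
    (h : IsTight (b :: c :: W)) {u v : List A} (e : b.1 ++ c.1 = u ++ v) (hu : EvalMem f T u)
    (hv : EvalMem f T v) (hu' : u.length ≤ N) (hv' : v.length ≤ N) : u.length ≤ b.1.length := by
  have := h [] [b, c] W [⟨u, hu', hu⟩, ⟨v, hv', hv⟩] rfl le_rfl le_rfl (by simpa using e)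
  have e' := congrArg List.length e
  simp [cost] at this e'
  omega

section Irreducible

variable {R : Set (List A × List A)} {m : ℕ}

theorem IsTight.le_length {b c : Block f T N} {W : List (Block f T N)}
    (h : IsTight (b :: c :: W))
    (hm : ∀ u, (∀ w, ¬ ListStep R u w) → m ≤ u.length → EvalMem f T u)
    (hi : ∀ w, ¬ ListStep R (expand (b :: c :: W)) w) {k : ℕ} (hk : m ≤ k) (hkN : k ≤ N)
    (hk' : k + m ≤ b.1.length + c.1.length) (hk'' : b.1.length + c.1.length ≤ k + N) :
    k ≤ b.1.length := by
  have e : b.1 ++ c.1 = (b.1 ++ c.1).take k ++ (b.1 ++ c.1).drop k :=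
    (List.take_append_drop _ _).symm
  have hl : ((b.1 ++ c.1).take k).length = k := by simp; omega
  have hl' : ((b.1 ++ c.1).drop k).length = b.1.length + c.1.length - k := by simp
  have hi' : ∀ w, ¬ ListStep R (b.1 ++ c.1) w :=
    irreducible_of_infix (x := []) (y := expand W) (by simpa using hi)
  have h₁ : ∀ w, ¬ ListStep R ((b.1 ++ c.1).take k) w :=
    irreducible_of_infix (x := []) (y := (b.1 ++ c.1).drop k) (by
      rw [List.nil_append, ← e]; exact hi')
  have h₂ : ∀ w, ¬ ListStep R ((b.1 ++ c.1).drop k) w :=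
    irreducible_of_infix (x := (b.1 ++ c.1).take k) (y := []) (by
      rw [List.append_nil, ← e]; exact hi')
  have := h.length_le e (hm _ h₁ (by omega)) (hm _ h₂ (by omega)) (by omega) (by omega)
  omega

/-- A tight spelling is greedy. With at most two blocks, the competing spelling is itself an
admissible respelling. With three or more, a first block shorter than `2 * m` could be lengthened at
the expense of the second. -/
theorem IsTight.head_length_le {b b' : Block f T (2 * m)} {W W' : List (Block f T (2 * m))}
    (h : IsTight (b :: W)) (hm0 : 0 < m)
    (hm : ∀ u, (∀ w, ¬ ListStep R u w) → m ≤ u.length → EvalMem f T u)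
    (hi : ∀ w, ¬ ListStep R (expand (b :: W)) w) (e : expand (b :: W) = expand (b' :: W')) :
    b'.1.length ≤ b.1.length := by
  have el := congrArg List.length e
  have hb' := b'.2.1
  simp only [expand_cons, List.length_append] at el
  rcases W with _ | ⟨c, _ | ⟨d, W⟩⟩
  · simp at el
    omega
  · have hbc := h.lt_length_add_length
    simp only [expand_cons, expand_nil, List.append_nil] at el e
    rcases eq_or_ne W' [] with rfl | hW'
    · simp at el
      omega
    · by_contra! hlt
      have hc := c.2.1
      exact absurd (h.length_le e b'.2.2 (evalMem_expand hW') hb' (by omega)) (by omega)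
  · by_contra! hlt
    have hbc := h.lt_length_add_length
    have hcd := h.tail.lt_length_add_length
    have hd := d.2.1
    have hc := c.2.1
    have hi' : ∀ w, ¬ ListStep R (expand (c :: d :: W)) w :=
      irreducible_of_infix (x := b.1) (y := []) (by simpa using hi)
    -- As `|c| + |d| > 2 * m`, a cut of `cd` after `m + 1` letters leaves at least `m`. So `c` can
    -- give up a letter to `b` and still have `m` left.
    have hc' : m + 1 ≤ c.1.length := by
      by_contra! hcm
      exact absurd (h.tail.le_length hm hi' (k := m + 1) (by omega) (by omega) (by omega)
        (by omega)) (by omega)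
    -- One letter more than `b`, but at least `m` letters, so that both parts have values in `T`.
    exact absurd (h.le_length hm hi (k := max (b.1.length + 1) m) (by omega) (by omega) (by omega)
      (by omega)) (by omega)

theorem IsTight.eq_of_expand_eq (hm0 : 0 < m)
    (hm : ∀ u, (∀ w, ¬ ListStep R u w) → m ≤ u.length → EvalMem f T u)
    {W W' : List (Block f T (2 * m))} (h : IsTight W) (h' : IsTight W')
    (hi : ∀ w, ¬ ListStep R (expand W) w) (e : expand W = expand W') : W = W' := by
  induction W generalizing W' with
  | nil => exact (expand_eq_nil_iff.1 e.symm).symm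
  | cons b W ih =>
    rcases W' with _ | ⟨b', W'⟩
    · exact expand_eq_nil_iff.1 e
    · have hl : b.1.length = b'.1.length :=
        le_antisymm (h'.head_length_le hm0 hm (e ▸ hi) e.symm) (h.head_length_le hm0 hm hi e)
      obtain ⟨hb, hW⟩ := List.append_inj e hl
      rw [Subtype.ext hb, ih h.tail h'.tail
        (irreducible_of_infix (x := b.1) (y := []) (by simpa using hi)) hW]

/-- Prefixes of length `m` are split off; while the word is longer than `2 * m`, the remainder has
more than `m` letters and so keeps its value in `T`. -/
theorem exists_expand_eq (hm : ∀ u, (∀ w, ¬ ListStep R u w) → m ≤ u.length → EvalMem f T u)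
    (hm0 : 0 < m) {u : List A} (hi : ∀ w, ¬ ListStep R u w) (hu : EvalMem f T u) :
    ∃ V : List (Block f T (2 * m)), expand V = u := by
  induction hn : u.length using Nat.strong_induction_on generalizing u with
  | _ n ih =>
    by_cases hle : u.length ≤ 2 * m
    · exact ⟨[⟨u, hle, hu⟩], by simp⟩
    · have e := List.take_append_drop m u
      have h₁ : ∀ w, ¬ ListStep R (u.take m) w :=
        irreducible_of_infix (x := []) (y := u.drop m) (by simpa using hi)
      have h₂ : ∀ w, ¬ ListStep R (u.drop m) w :=
        irreducible_of_infix (x := u.take m) (y := []) (by simpa using hi)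
      have hl : (u.take m).length = m := by simp; omega
      have hl' : (u.drop m).length = u.length - m := by simp
      obtain ⟨V, hV⟩ := ih _ (by omega) h₂ (hm _ h₂ (by omega)) rfl
      exact ⟨⟨u.take m, by omega, hm _ h₁ hl.ge⟩ :: V, by simp [hV]⟩

end Irreducible

theorem exists_prefix_cover {W : List (Block f T N)} {l c : List A} (h : expand W = l ++ c) :
    ∃ V y, W = V ++ y ∧ l <+: expand V ∧ V.length ≤ l.length := by
  induction W generalizing l with
  | nil => exact ⟨[], [], rfl, ⟨c, h.symm⟩, by simp⟩
  | cons b W ih =>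
    rcases eq_or_ne l [] with rfl | hl
    · exact ⟨[], b :: W, rfl, List.nil_prefix, by simp⟩
    · rcases List.append_eq_append_iff.1 h with ⟨l', rfl, h'⟩ | ⟨b', hb, -⟩
      · obtain ⟨V, y, rfl, hV, hlen⟩ := ih h'
        refine ⟨b :: V, y, rfl, (List.prefix_append_right_inj _).2 hV, ?_⟩
        have := b.2.2.length_pos
        simp
        omega
      · exact ⟨[b], W, rfl, ⟨b', by simp [hb]⟩, List.length_pos_iff.2 hl⟩

/-- Blocks are non-empty, so each block after the first uses up a letter of `l`. The first may
contribute none, whence the `+ 1`. -/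
theorem exists_infix_cover {W : List (Block f T N)} {a l c : List A}
    (h : expand W = a ++ l ++ c) :
    ∃ x V y, W = x ++ V ++ y ∧ l <:+: expand V ∧ V.length ≤ l.length + 1 := by
  induction W generalizing a with
  | nil => exact ⟨[], [], [], rfl, ⟨a, c, h.symm⟩, by simp⟩
  | cons b W ih =>
    rw [expand_cons, List.append_assoc] at h
    rcases List.append_eq_append_iff.1 h with ⟨a', rfl, h'⟩ | ⟨b', hb, h'⟩
    · obtain ⟨x, V, y, rfl, hV, hlen⟩ := ih (a := a') (by rw [h', List.append_assoc])
      exact ⟨b :: x, V, y, rfl, hV, hlen⟩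
    · rcases List.append_eq_append_iff.1 h' with ⟨d, hd, -⟩ | ⟨l', rfl, h''⟩
      · exact ⟨[], [b], W, rfl, ⟨a, d, by simp [hb, hd]⟩, by simp⟩
      · obtain ⟨V, y, rfl, ⟨z, hz⟩, hlen⟩ := exists_prefix_cover h''
        exact ⟨[], b :: V, y, rfl, ⟨a, z, by simp [hb, ← hz]⟩, by simp; omega⟩

end Blocks

/-! ### From `S` to `T` -/

section Subsemigroup

variable {A S : Type*} [Semigroup S] {f : A → S} {T : Subsemigroup S} {N : ℕ}

/-- Rules on blocks: words of at most `K` blocks that spell a reducible word are reduced by `can`,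
and words of at most two blocks are respelled by as many or fewer blocks at lower cost. -/
def blockRules (R : Set (List A × List A)) (K : ℕ)
    (can : List (Block f T N) → List (Block f T N)) :
    Set (List (Block f T N) × List (Block f T N)) :=
  (fun V => (V, can V)) '' {V | V.length ≤ K ∧ ∃ w, ListStep R (expand V) w} ∪
    {p | p.1.length ≤ 2 ∧ p.2.length ≤ p.1.length ∧ expand p.1 = expand p.2 ∧ cost p.2 < cost p.1}

variable {R : Set (List A × List A)} {K : ℕ} {can : List (Block f T N) → List (Block f T N)}

theorem finite_blockRules [Finite A] : (blockRules R K can).Finite := by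
  have : Finite (Block f T N) :=
    ((List.finite_length_le A N).subset fun u hu => hu.1).to_subtype
  refine (((List.finite_length_le _ K).subset fun V hV => hV.1).image _).union ?_
  exact ((List.finite_length_le _ 2).prod (List.finite_length_le _ 2)).subset
    fun p hp => ⟨hp.1, hp.2.1.trans hp.1⟩

/-- The spelled word decreases under `R`, or stays the same while the cost drops. In the second case
the number of blocks does not grow, so the later blocks do not raise the cost of the earlier part.
-/
theorem wellFounded_blockRules (wf : WellFounded fun v u => ListStep R u v)
    (hcan : ∀ V, (∃ w, ListStep R (expand V) w) →
      Relation.TransGen (ListStep R) (expand V) (expand (can V))) :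
    WellFounded fun v u => ListStep (blockRules R K can) u v := by
  have hwf := wf.transGen.prod_lex (wellFounded_lt (α := ℕ))
  refine Subrelation.wf ?_ (InvImage.wf
    (fun W : List (Block f T N) => (expand W, cost W)) hwf)
  rintro v u ⟨p, hp, x, y, rfl, rfl⟩
  simp only [InvImage, Prod.lex_def]
  rcases hp with ⟨V, ⟨-, hV⟩, rfl⟩ | ⟨-, hl, he, hc⟩
  · left
    refine Relation.transGen_swap.2 ?_
    simp only [expand_append]
    exact (hcan V hV).lift (fun u => expand x ++ u ++ expand y) fun _ _ h => h.context _ _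
  · right
    refine ⟨by simp [he], ?_⟩
    simp only [cost_append, List.length_append, he, add_mul]
    have := Nat.mul_le_mul_right (expand y).length hl
    omega

theorem IsCompletePresentation.blockPresentation {m : ℕ} (h : IsCompletePresentation ⊤ R f)
    (hm0 : 0 < m) (hm : ∀ u, (∀ w, ¬ ListStep R u w) → m ≤ u.length → EvalMem f T u)
    (hK : ∀ p ∈ R, p.1.length < K) :
    ∃ (can : List (Block f T (2 * m)) → List (Block f T (2 * m))) (g : Block f T (2 * m) → S),
      IsCompletePresentation T (blockRules R K can) g := by
  have hg : ∀ b : Block f T (2 * m), ∃ t ∈ T, wordEval f b.1 = t := fun b => b.2.2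
  choose g hgT hg using hg
  have geval : ∀ V, wordEval g V = wordEval f (expand V) := fun V => by
    induction V with
    | nil => simp
    | cons b V ih => simp [ih, hg]
  have key : ∀ V : List (Block f T (2 * m)), (∃ w, ListStep R (expand V) w) →
      ∃ V' : List (Block f T (2 * m)),
        Relation.TransGen (ListStep R) (expand V) (expand V') := by
    rintro V ⟨w, hw⟩
    have hV : V ≠ [] := by
      rintro rfl
      obtain ⟨p, hp, x, y, hxy, -⟩ := hw
      have := h.fst_ne_nil p hp
      simp_all
    obtain ⟨z, hz, hi⟩ := exists_irreducible h.wf w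
    have hz' := Relation.TransGen.head' hw hz
    have hmem : EvalMem f T z := by
      rw [EvalMem, ← wordEval_eq_of_reduces h.sound hz'.to_reflTransGen]
      exact evalMem_expand hV
    obtain ⟨V', rfl⟩ := exists_expand_eq hm hm0 hi hmem
    exact ⟨V', hz'⟩
  choose! can hcan using key
  have sound : ∀ p ∈ blockRules R K can, wordEval g p.1 = wordEval g p.2 := by
    rintro _ (⟨V, ⟨-, hV⟩, rfl⟩ | ⟨-, -, he, -⟩)
    · simpa only [geval] using wordEval_eq_of_reduces h.sound (hcan V hV).to_reflTransGen
    · rw [geval, geval, he]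
  have fst : ∀ p ∈ blockRules R K can, p.1 ≠ [] := by
    rintro _ (⟨V, ⟨-, w, p, hp, x, y, hxy, -⟩, rfl⟩ | ⟨-, -, -, hc⟩) h0
    · have := h.fst_ne_nil p hp
      simp_all
    · simp [h0, cost] at hc
  have irr : ∀ W, (∀ W', ¬ ListStep (blockRules R K can) W W') →
      (∀ w, ¬ ListStep R (expand W) w) ∧ IsTight W := by
    refine fun W hW => ⟨?_, ?_⟩
    · rintro w ⟨p, hp, x, y, hxy, -⟩
      -- The left side of a rule is covered by at most its length plus one blocks, which the strict
      -- bound by `K` allows.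
      obtain ⟨x, V, y, rfl, ⟨a, c, hac⟩, hlen⟩ := exists_infix_cover hxy
      exact hW _ ⟨_, Or.inl ⟨V, ⟨hlen.trans (hK p hp), _, p, hp, a, c, hac.symm, rfl⟩, rfl⟩,
        x, y, rfl, rfl⟩
    · rintro x V y V' rfl hV hV' he
      by_contra! hc
      exact hW _ ⟨(V, V'), Or.inr ⟨hV, hV', he, hc⟩, x, y, rfl, rfl⟩
  refine ⟨can, g, fst, fun p hp h0 => fst p hp ?_, hgT, sound, ?_,
    wellFounded_blockRules h.wf hcan, ?_⟩
  · rw [← wordEval_eq_one_iff (f := g), sound p hp, h0, wordEval_nil]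
  · intro t ht
    obtain ⟨u, hu⟩ := h.surj t trivial
    obtain ⟨z, hz, hi⟩ := exists_irreducible h.wf u
    have hzt := (wordEval_eq_of_reduces h.sound hz).symm.trans hu
    obtain ⟨V, rfl⟩ := exists_expand_eq hm hm0 hi ⟨t, ht, hzt⟩
    exact ⟨V, by rw [geval, hzt]⟩
  · intro W W' hW hW' he
    rw [geval, geval] at he
    obtain ⟨hi, ht⟩ := irr W hW
    obtain ⟨hi', ht'⟩ := irr W' hW'
    exact ht.eq_of_expand_eq hm0 hm ht' hi (h.inj _ _ hi hi' he)

end Subsemigroup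

/-- Evaluation is injective on irreducible words, so finitely many have values in the finite set `S
\ T`; `m` exceeds their lengths. -/
theorem IsCompletePresentation.exists_evalMem_of_le_length {A S : Type*} [Semigroup S]
    {R : Set (List A × List A)} {f : A → S} (h : IsCompletePresentation ⊤ R f)
    {T : Subsemigroup S} (hT : ((T : Set S)ᶜ).Finite) :
    ∃ m, 0 < m ∧ ∀ u, (∀ w, ¬ ListStep R u w) → m ≤ u.length → EvalMem f T u := by
  have hfin : {u : List A | (∀ w, ¬ ListStep R u w) ∧ u ≠ [] ∧ ¬ EvalMem f T u}.Finite := by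
    refine Set.Finite.of_injOn (f := wordEval f)
      (t := (fun s : S => (s : WithOne S)) '' (T : Set S)ᶜ) ?_ ?_ (hT.image _)
    · rintro u ⟨-, hu, hu'⟩
      obtain ⟨s, -, hs⟩ := exists_wordEval_eq h.mem hu
      exact ⟨s, fun hsT => hu' ⟨s, hsT, hs⟩, hs.symm⟩
    · exact fun u hu v hv e => h.inj u v hu.1 hv.1 e
  obtain ⟨n, hn⟩ := (hfin.image List.length).bddAbove
  refine ⟨n + 1, n.succ_pos, fun u hu hl => ?_⟩
  by_contra hmem
  have : u.length ≤ n := hn ⟨u, ⟨hu, by rintro rfl; simp at hl, hmem⟩, rfl⟩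
  omega

theorem hasFiniteCompleteRewritingSystem_subsemigroup {S : Type*} [Semigroup S]
    {T : Subsemigroup S} (hT : IsSmallExtension T) (h : HasFiniteCompleteRewritingSystem S) :
    HasFiniteCompleteRewritingSystem T := by
  obtain ⟨A, R, f, hA, hR, hp⟩ := exists_isCompletePresentation (T := (⊤ : Subsemigroup S))
    (h.congr Subsemigroup.topEquiv.symm)
  obtain ⟨m, hm0, hm⟩ := hp.exists_evalMem_of_le_length hT.2
  obtain ⟨K, hK⟩ := (hR.image fun p => p.1.length).bddAbove
  obtain ⟨can, g, hg⟩ := hp.blockPresentation (K := K + 1) hm0 hm fun p hpR =>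
    Nat.lt_succ_of_le (hK ⟨p, hpR, rfl⟩)
  have : Finite (Block f T (2 * m)) :=
    ((List.finite_length_le A (2 * m)).subset fun u hu => hu.1).to_subtype
  exact hasFiniteCompleteRewritingSystem_of_isCompletePresentation hT.1 finite_blockRules hg

end StringRewriting

theorem corollary1p2 {S : Type*} [Semigroup S] (T : Subsemigroup S)
    (hT : StringRewriting.IsSmallExtension T) :
    StringRewriting.HasFiniteCompleteRewritingSystem S ↔
      StringRewriting.HasFiniteCompleteRewritingSystem T :=
  ⟨StringRewriting.hasFiniteCompleteRewritingSystem_subsemigroup hT,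
    StringRewriting.hasFiniteCompleteRewritingSystem_of_subsemigroup hT⟩
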